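/- Let $n\ge 0$ and let $\Pi=\{\epsilon_1-\epsilon_2,\dots,\epsilon_{n-1}-\epsilon_n\}$ be the set of simple roots of the symmetric group $S_n$. For $L\subseteq\Pi$ let $S_L\le S_n$ be the parabolic subgroup generated by the transpositions $(i\;\,i{+}1)$ with $\epsilon_i-\epsilon_{i+1}\in L$. The descent set of $g\in S_n$ is the set of $\epsilon_i-\epsilon_{i+1}\in\Pi$ with $g(i)>g(i+1)$ (the simple roots that $g$ maps to negative roots), and $X_L$ denotes the set of permutations whose descent set is disjoint from $L$, identified with the sum of its elements in the group algebra $\mathbb{C}[S_n]$. For a finite group $G$, let $\mathrm{Irr}(G)$ be the set of isomorphism classes of irreducible complex representations of $G$; for a subgroup $H\le G$, $\tau\in\mathrm{Irr}(H)$ and $\rho\in\mathrm{Irr}(G)$, let $\kappa(\tau,\rho)$ be the multiplicity of $\tau$ in $\mathrm{Res}^G_H(\rho)$. The Markov chain on $\mathrm{Irr}(G)$ associated with $(G,H)$ moves from $\rho$ to $\sigma$ with probability $$\frac{|H|}{|G|}\,\frac{\dim\sigma}{\dim\rho}\sum_{\tau\in\mathrm{Irr}(H)}\kappa(\tau,\rho)\,\kappa(\tau,\sigma).$$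 Write $J[L]$ for this chain when $G=S_n$ and $H=S_L$. Let $\vec p=(p_L)_{L\subseteq\Pi}$ be real numbers with $p_L\ge 0$ and $\sum_{L\subseteq\Pi}p_L=1$, and put $J[\vec p]=\sum_{L\subseteq\Pi}p_L\,J[L]$, acting on functions $f:\mathrm{Irr}(S_n)\to\mathbb{C}$ by $(J[\vec p]f)(\rho)=\sum_{\sigma}J[\vec p](\rho,\sigma)f(\sigma)$. **Proposition.** The operator $J[\vec p]$ and the element $$\sum_{L\subseteq\Pi}\frac{p_L\,|S_L|}{n!}\,X_L\in\mathbb{C}[S_n]$$ have the same set of (complex) eigenvalues, multiplicities not being counted, where the eigenvalues of the element are those of multiplication by it on $\mathbb{C}[S_n]$; this holds both for left multiplication and for right multiplication. -/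

import Mathlib

noncomputable section

namespace IrrChain

open CategoryTheory

/-- Isomorphism, as an equivalence relation on the irreducible finite-dimensional complex
representations of `G`. -/
def irrSetoid (G : Type) [Group G] : Setoid {V : FDRep ℂ G // Simple V} where
  r V W := Nonempty (V.1 ≅ W.1)
  iseqv :=
    { refl := fun V => ⟨Iso.refl V.1⟩
      symm := fun ⟨e⟩ => ⟨e.symm⟩
      trans := fun ⟨e⟩ ⟨f⟩ => ⟨e ≪≫ f⟩ }

/-- `Irr G`: the set of isomorphism classes of irreducible (finite-dimensional complex)
representations of `G`. -/
def Irr (G : Type) [Group G] : Type 1 := Quotient (irrSetoid G)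

/-- A representation in the class `ρ` (everything below depends only on its isomorphism class). -/
def Irr.rep {G : Type} [Group G] (ρ : Irr G) : FDRep ℂ G := (Quotient.out ρ).1

theorem Irr.simple_rep {G : Type} [Group G] (ρ : Irr G) : Simple ρ.rep := (Quotient.out ρ).2

theorem Irr.eq_of_iso {G : Type} [Group G] {ρ σ : Irr G} (h : Nonempty (ρ.rep ≅ σ.rep)) :
    ρ = σ := by
  have h' : Quotient.mk (irrSetoid G) (Quotient.out ρ) =
      Quotient.mk (irrSetoid G) (Quotient.out σ) := Quotient.sound h
  exact (Quotient.out_eq ρ).symm.trans (h'.trans (Quotient.out_eq σ))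

/-- A finite group has finitely many irreducible representations up to isomorphism. -/
instance Irr.finite (G : Type) [Group G] [Finite G] : Finite (Irr G) := by
  classical
  have := Fintype.ofFinite G
  have hG : (Nat.card G : ℂ) ≠ 0 := Nat.cast_ne_zero.2 Nat.card_pos.ne'
  have : Invertible (Nat.card G : ℂ) := invertibleOfNonzero hG
  have orth : ∀ ρ σ : Irr G, (Nat.card G : ℂ)⁻¹ *
      ∑ g : G, ρ.rep.character g * σ.rep.character g⁻¹ = if ρ = σ then 1 else 0 := by
    intro ρ σ
    have := ρ.simple_rep
    have := σ.simple_rep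
    rw [FDRep.char_orthonormal]
    by_cases h : ρ = σ
    · subst h
      rw [if_pos rfl, if_pos ⟨Iso.refl _⟩]
    · rw [if_neg h, if_neg (fun e => h (Irr.eq_of_iso e))]
  have hli : LinearIndependent ℂ (fun ρ : Irr G => (ρ.rep.character : G → ℂ)) := by
    rw [linearIndependent_iff']
    intro s c hc σ hσ
    have h1 : ∀ g : G, ∑ ρ ∈ s, c ρ * ρ.rep.character g = 0 := by
      intro g
      have := congrFun hc g
      simpa using this
    have h2 : ∑ ρ ∈ s, c ρ * ((Nat.card G : ℂ)⁻¹ *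
        ∑ g : G, ρ.rep.character g * σ.rep.character g⁻¹) = 0 := by
      calc _ = (Nat.card G : ℂ)⁻¹ *
            ∑ g : G, (∑ ρ ∈ s, c ρ * ρ.rep.character g) * σ.rep.character g⁻¹ := by
            simp_rw [Finset.sum_mul, Finset.mul_sum]
            rw [Finset.sum_comm]
            refine Finset.sum_congr rfl fun g _ => Finset.sum_congr rfl fun ρ _ => by ring
        _ = 0 := by simp [h1]
    simp_rw [orth] at h2
    simpa [hσ] using h2
  exact hli.finite

instance Irr.fintype (G : Type) [Group G] [Finite G] : Fintype (Irr G) := Fintype.ofFinite _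

/-- The dimension of an irreducible representation. -/
def Irr.dim {G : Type} [Group G] (ρ : Irr G) : ℕ := Module.finrank ℂ ρ.rep

/-- The restriction of a representation of `G` to a subgroup `H`. -/
def res {G : Type} [Group G] (H : Subgroup G) (V : FDRep ℂ G) : FDRep ℂ H :=
  FDRep.of (V.ρ.comp H.subtype)

/-- `κ(τ, ρ)`: the multiplicity of the irreducible representation `τ` of `H` in the restriction
of `ρ` to `H`, that is, `dim Hom_H(τ, Res ρ)`. -/
def mult {G : Type} [Group G] (H : Subgroup G) (τ : Irr H) (ρ : Irr G) : ℕ :=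
  Module.finrank ℂ (τ.rep ⟶ res H ρ.rep)

/-- The transition probabilities `J(ρ, σ)` of the Markov chain on `Irr G` attached to a subgroup
`H` of the finite group `G`. -/
def chain {G : Type} [Group G] [Finite G] (H : Subgroup G) : Matrix (Irr G) (Irr G) ℝ :=
  fun ρ σ => (Nat.card H : ℝ) / (Nat.card G : ℝ) * ((σ.dim : ℝ) / (ρ.dim : ℝ)) *
    ∑ τ : Irr H, (mult H τ ρ : ℝ) * (mult H τ σ : ℝ)

/-- The index `i : Fin (n - 1)` stands for the simple root `ε_{i+1} - ε_{i+2}` (positions counted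
from `1`), that is, for the pair of adjacent positions `lo i`, `hi i` of `Fin n`. -/
def lo {n : ℕ} (i : Fin (n - 1)) : Fin n := ⟨i.1, by omega⟩

/-- The second of the two adjacent positions attached to `i`. -/
def hi {n : ℕ} (i : Fin (n - 1)) : Fin n := ⟨i.1 + 1, by omega⟩

/-- The parabolic subgroup `S_L`, generated by the adjacent transpositions in `L`. -/
def parabolic {n : ℕ} (L : Finset (Fin (n - 1))) : Subgroup (Equiv.Perm (Fin n)) :=
  Subgroup.closure {s | ∃ i ∈ L, s = Equiv.swap (lo i) (hi i)}

/-- The descent set of `g`: the simple roots `ε_j - ε_{j+1}` for which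
`ε_{g(j)} - ε_{g(j+1)}` is negative. -/
def descents {n : ℕ} (g : Equiv.Perm (Fin n)) : Finset (Fin (n - 1)) :=
  Finset.univ.filter fun i => g (hi i) < g (lo i)

/-- The set `X_L` of permutations whose descent set is disjoint from `L`. -/
def descentFree {n : ℕ} (L : Finset (Fin (n - 1))) : Finset (Equiv.Perm (Fin n)) :=
  Finset.univ.filter fun g => Disjoint (descents g) L

/-- The element `∑_L (p_L |S_L| / n!) X_L` of the group algebra of `S_n`. -/
def shuffle {n : ℕ} (p : Finset (Fin (n - 1)) → ℝ) : MonoidAlgebra ℂ (Equiv.Perm (Fin n)) :=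
  ∑ L : Finset (Fin (n - 1)), ∑ g ∈ descentFree L,
    MonoidAlgebra.single g
      (((p L * (Nat.card (parabolic L) : ℝ) / (n.factorial : ℝ) : ℝ)) : ℂ)

/-- The mixture `J[p] = ∑_L p_L J[L]`, where `J[L]` is the chain for `G = S_n`, `H = S_L`. -/
def mixedChain {n : ℕ} (p : Finset (Fin (n - 1)) → ℝ) :
    Matrix (Irr (Equiv.Perm (Fin n))) (Irr (Equiv.Perm (Fin n))) ℝ :=
  ∑ L : Finset (Fin (n - 1)), p L • chain (parabolic L)

/-- The operator `f ↦ (x ↦ ∑_y M(x, y) f(y))` of a transition matrix `M`, on complex functions. -/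
def transitionOp {X : Type*} [Fintype X] (M : Matrix X X ℝ) : Module.End ℂ (X → ℂ) :=
  (M.map (fun t : ℝ => (t : ℂ))).mulVecLin

/-- The set of eigenvalues of a linear operator. -/
def eigenvalueSet {V : Type*} [AddCommGroup V] [Module ℂ V] (T : Module.End ℂ V) : Set ℂ :=
  {z | T.HasEigenvalue z}

end IrrChain

end

/-! Both spectra equal the set of numbers `∑ L, p L * conjRatio (parabolic L) h`, where `h` runs
over `S_n` and `conjRatio H h` is the proportion of `k` with `k * h * k⁻¹ ∈ H`.

For the chain, the column `charRatio g` of normalized character values is an eigenfunction for every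
subgroup at once (`sum_chain_mul_charRatio`). These columns are nonzero and span all functions, so
no other eigenvalue exists. The input is column orthogonality of the character table,
`sum_irr_character_mul_character`.

For the group algebra element, the argument is Bidigare's. The faces of the braid arrangement form a
monoid under the Tits product, and `S_n` acts on it. The invariant element `weight p` multiplies
chambers on the left as `shuffle p` multiplies permutations on the right (`weight_mul_chamberMap`).
An invariant element is determined by its product with the fundamental chamber
(`eq_zero_of_mul_base_eq_zero`), so `shuffle p` and `weight p` are annihilated by the same
polynomials. Right multiplication by `weight p` on the face algebra is triangular for the refinement
order, with diagonal entries `F.char (weight p)`. Each such entry is a `conjRatio` mixture at a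
permutation whose cycles are the blocks of `F` (`char_weight`).

Left and right multiplication by an element have that element's own minimal polynomial, so the two
sides need no separate treatment. -/

noncomputable section

namespace IrrChain

open CategoryTheory

/-! ### Completeness of the irreducible characters and column orthogonality -/

section Completeness

variable {G : Type} [Group G]

/-- Every irreducible representation is equivalent to the chosen representative of its class. -/
theorem exists_irr_iso (V : FDRep ℂ G) [hV : Simple V] : ∃ σ : Irr G, Nonempty (σ.rep ≅ V) :=
  ⟨Quotient.mk (irrSetoid G) ⟨V, hV⟩, Quotient.mk_out (s := irrSetoid G) ⟨V, hV⟩⟩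

/-- The representation of `G` on a module over the group algebra. -/
def moduleRep (M : Type) [AddCommGroup M] [Module ℂ M] [Module (MonoidAlgebra ℂ G) M]
    [IsScalarTower ℂ (MonoidAlgebra ℂ G) M] : Representation ℂ G M :=
  ((Algebra.lsmul ℂ ℂ M : MonoidAlgebra ℂ G →ₐ[ℂ] Module.End ℂ M) :
    MonoidAlgebra ℂ G →* Module.End ℂ M).comp (MonoidAlgebra.of ℂ G)

theorem asAlgebraHom_moduleRep (M : Type) [AddCommGroup M] [Module ℂ M]
    [Module (MonoidAlgebra ℂ G) M] [IsScalarTower ℂ (MonoidAlgebra ℂ G) M] :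
    (moduleRep (G := G) M).asAlgebraHom = Algebra.lsmul ℂ ℂ M := by
  ext g v
  simp [moduleRep]

theorem isIrreducible_moduleRep (M : Type) [AddCommGroup M] [Module ℂ M]
    [Module (MonoidAlgebra ℂ G) M] [IsScalarTower ℂ (MonoidAlgebra ℂ G) M]
    [IsSimpleModule (MonoidAlgebra ℂ G) M] : (moduleRep (G := G) M).IsIrreducible := by
  rw [Representation.irreducible_iff_isSimpleModule_asModule]
  let e : (moduleRep (G := G) M).asModule ≃ₗ[MonoidAlgebra ℂ G] M :=
    { (moduleRep (G := G) M).asModuleEquiv.toAddEquiv with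
      map_smul' := fun r x => by
        change (moduleRep (G := G) M).asModuleEquiv (r • x) = _
        rw [Representation.asModuleEquiv_map_smul, asAlgebraHom_moduleRep]
        rfl }
  exact IsSimpleModule.congr e

variable [Fintype G]

/-- Schur's lemma for the central element attached to a class function. -/
theorem sum_smul_eq_zero_of_irreducible {V : Type} [AddCommGroup V] [Module ℂ V]
    [FiniteDimensional ℂ V] (ρ : Representation ℂ G V) [ρ.IsIrreducible] (φ : G → ℂ)
    (hφ : ∀ g k, φ (k * g * k⁻¹) = φ g) (h0 : ∑ g, φ g * ρ.character g = 0) :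
    ∑ g, φ g • ρ g = 0 := by
  have hcomm : ∀ k : G, (∑ g, φ g • ρ g) ∘ₗ ρ k = ρ k ∘ₗ (∑ g, φ g • ρ g) := by
    intro k
    change (∑ g, φ g • ρ g) * ρ k = ρ k * (∑ g, φ g • ρ g)
    rw [Finset.sum_mul, Finset.mul_sum]
    refine Fintype.sum_equiv (MulAut.conj k⁻¹).toEquiv _ _ fun g => ?_
    simp only [MulEquiv.toEquiv_eq_coe, EquivLike.coe_coe, MulAut.conj_apply, smul_mul_assoc,
      mul_smul_comm, hφ, ← map_mul]
    congr 2
    group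
  let f : Representation.IntertwiningMap ρ ρ := ⟨∑ g, φ g • ρ g, hcomm⟩
  -- By Schur's lemma the sum is a scalar `c`; its trace `c * dim V` is the pairing assumed to
  -- vanish.
  obtain ⟨c, hc⟩ :=
    Representation.IsIrreducible.algebraMap_intertwiningMap_bijective_of_isAlgClosed.2 f
  have hc' : (∑ g, φ g • ρ g) = c • (1 : V →ₗ[ℂ] V) := by
    have := congrArg (fun f => f.toLinearMap) hc
    simp only [f] at this
    rw [← this]
    ext v
    simp [Algebra.algebraMap_eq_smul_one]
  have htr := congrArg (LinearMap.trace ℂ V) hc'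
  have hdim : (Module.finrank ℂ V : ℂ) ≠ 0 := by
    have := ‹ρ.IsIrreducible›.toNontrivial
    have : Nontrivial V := by
      by_contra hV
      rw [not_nontrivial_iff_subsingleton] at hV
      obtain ⟨a, b, hab⟩ := this
      apply hab
      ext v
      rw [Subsingleton.elim v 0]
      exact iff_of_true a.toSubmodule.zero_mem b.toSubmodule.zero_mem
    exact Nat.cast_ne_zero.2 Module.finrank_pos.ne'
  have : c = 0 := by
    have h1 : (LinearMap.trace ℂ V) (∑ g, φ g • ρ g) = 0 := by
      simpa [Representation.character] using h0
    rw [h1] at htr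
    simpa [hdim] using htr.symm
  rw [hc', this, zero_smul]

/-- Schur's lemma makes the self-intertwiners one-dimensional, so the character has norm one, which
characterizes simple objects of `FDRep`. -/
theorem simple_of_isIrreducible {V : Type} [AddCommGroup V] [Module ℂ V]
    [FiniteDimensional ℂ V] (ρ : Representation ℂ G V) [ρ.IsIrreducible] :
    Simple (FDRep.of ρ) := by
  have hG : (Nat.card G : ℂ) ≠ 0 := Nat.cast_ne_zero.2 Nat.card_pos.ne'
  have : Invertible (Nat.card G : ℂ) := invertibleOfNonzero hG
  rw [FDRep.simple_iff_char_is_norm_one]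
  have h := Representation.card_inv_mul_sum_char_mul_char_eq_finrank ρ ρ
  rw [Representation.IsIrreducible.finrank_intertwiningMap_self] at h
  have h' : ∑ g : G, ρ.character g * ρ.character g⁻¹ = Nat.card G := by
    field_simp at h
    simpa using h
  exact h'

/-- The central element attached to a class function which is orthogonal to all irreducible
characters acts as zero on simple modules. -/
theorem sum_single_smul_eq_zero (φ : G → ℂ) (hφ : ∀ g k, φ (k * g * k⁻¹) = φ g)
    (h0 : ∀ σ : Irr G, ∑ g, φ g * σ.rep.character g = 0) (M : Type) [AddCommGroup M]
    [Module ℂ M] [FiniteDimensional ℂ M] [Module (MonoidAlgebra ℂ G) M]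
    [IsScalarTower ℂ (MonoidAlgebra ℂ G) M]
    [IsSimpleModule (MonoidAlgebra ℂ G) M] (v : M) :
    (∑ g, MonoidAlgebra.single g (φ g)) • v = 0 := by
  have hirr := isIrreducible_moduleRep (G := G) M
  have hs := simple_of_isIrreducible (moduleRep (G := G) M)
  obtain ⟨σ, ⟨i⟩⟩ := exists_irr_iso (FDRep.of (moduleRep (G := G) M))
  have h1 := h0 σ
  rw [FDRep.char_iso i] at h1
  have h2 := sum_smul_eq_zero_of_irreducible (moduleRep (G := G) M) φ hφ h1
  have h3 := congrArg (fun f => f v) h2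
  simp only [LinearMap.sum_apply, LinearMap.smul_apply, LinearMap.zero_apply] at h3
  rw [Finset.sum_smul, ← h3]
  refine Finset.sum_congr rfl fun g _ => ?_
  change _ = φ g • (MonoidAlgebra.single g (1 : ℂ) • v)
  rw [← smul_assoc, MonoidAlgebra.smul_single, smul_eq_mul, mul_one]

/-- A class function which is orthogonal to all irreducible characters vanishes. -/
theorem classFunction_eq_zero (φ : G → ℂ) (hφ : ∀ g k, φ (k * g * k⁻¹) = φ g)
    (h0 : ∀ σ : Irr G, ∑ g, φ g * σ.rep.character g = 0) : φ = 0 := by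
  have hG : (Nat.card G : ℂ) ≠ 0 := Nat.cast_ne_zero.2 Nat.card_pos.ne'
  have : NeZero (Nat.card G : ℂ) := ⟨hG⟩
  have key (N : Submodule (MonoidAlgebra ℂ G) (MonoidAlgebra ℂ G))
      (hN : IsSimpleModule (MonoidAlgebra ℂ G) N) (v : MonoidAlgebra ℂ G) (hv : v ∈ N) :
      (∑ g, MonoidAlgebra.single g (φ g)) * v = 0 :=
    have : FiniteDimensional ℂ N := inferInstanceAs (FiniteDimensional ℂ (N.restrictScalars ℂ))
    congrArg Subtype.val (sum_single_smul_eq_zero φ hφ h0 N ⟨v, hv⟩)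
  have hz : ∀ v : MonoidAlgebra ℂ G, (∑ g, MonoidAlgebra.single g (φ g)) * v = 0 := by
    intro v
    -- By Maschke's theorem the group algebra is the sum of its simple left ideals, each killed by
    -- the central element. Evaluating at `1` then shows that the element itself is zero.
    have htop := IsSemisimpleModule.sSup_simples_eq_top (MonoidAlgebra ℂ G) (MonoidAlgebra ℂ G)
    have hv : v ∈ sSup {m : Submodule (MonoidAlgebra ℂ G) (MonoidAlgebra ℂ G) |
        IsSimpleModule (MonoidAlgebra ℂ G) m} := by
      rw [htop]; trivial
    rw [sSup_eq_iSup'] at hv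
    induction hv using Submodule.iSup_induction' with
    | mem i x hx => exact key i.1 i.2 x hx
    | zero => rw [mul_zero]
    | add x y _ _ hx hy => rw [mul_add, hx, hy, add_zero]
  ext g
  have h1 := congrArg (fun z => z.coeff g) (hz 1)
  classical
  simpa [Finsupp.single_apply] using h1

open scoped Classical in
/-- The first orthogonality relation. -/
theorem sum_character_mul_character_inv (ρ σ : Irr G) :
    ∑ g : G, ρ.rep.character g * σ.rep.character g⁻¹ = if ρ = σ then (Nat.card G : ℂ) else 0 := by
  have hG : (Nat.card G : ℂ) ≠ 0 := Nat.cast_ne_zero.2 Nat.card_pos.ne'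
  have : Invertible (Nat.card G : ℂ) := invertibleOfNonzero hG
  have := ρ.simple_rep
  have := σ.simple_rep
  have h := FDRep.char_orthonormal ρ.rep σ.rep
  by_cases e : ρ = σ
  · subst e
    rw [if_pos ⟨Iso.refl _⟩] at h
    rw [if_pos rfl]
    field_simp at h
    simpa using h
  · rw [if_neg (fun e' => e (Irr.eq_of_iso e'))] at h
    rw [if_neg e]
    simpa [hG] using h

/-- The second orthogonality relation. -/
theorem sum_irr_character_mul_character (g h : G) [DecidableEq G] :
    ∑ σ : Irr G, σ.rep.character h⁻¹ * σ.rep.character g =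
      ((Finset.univ.filter fun k : G => k * g * k⁻¹ = h).card : ℂ) := by
  classical
  -- The difference of the two sides, taken at `g⁻¹` so that row orthogonality applies directly.
  -- Both terms pair with the character of `τ` to `|G|` times its value at `h⁻¹`.
  let φ : G → ℂ := fun g => ∑ σ : Irr G, σ.rep.character h⁻¹ * σ.rep.character g⁻¹ -
    ((Finset.univ.filter fun k : G => k * g⁻¹ * k⁻¹ = h).card : ℂ)
  have hφ : φ = 0 := by
    refine classFunction_eq_zero φ ?_ ?_
    · intro g k
      simp only [φ]
      congr 1
      · refine Finset.sum_congr rfl fun σ _ => ?_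
        rw [show (k * g * k⁻¹)⁻¹ = k * g⁻¹ * k⁻¹ by group, FDRep.char_conj]
      · congr 1
        refine Finset.card_bij (fun a _ => a * k) ?_ ?_ ?_
        · intro a ha
          simp only [Finset.mem_filter, Finset.mem_univ, true_and] at ha ⊢
          rw [← ha]; group
        · intro a _ b _ hab
          exact mul_right_cancel hab
        · intro b hb
          refine ⟨b * k⁻¹, ?_, by group⟩
          simp only [Finset.mem_filter, Finset.mem_univ, true_and] at hb ⊢
          rw [← hb]; group
    · intro τ
      simp only [φ, sub_mul, Finset.sum_sub_distrib, Finset.sum_mul]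
      rw [Finset.sum_comm]
      have h1 : ∀ σ : Irr G, ∑ g : G, σ.rep.character h⁻¹ * σ.rep.character g⁻¹ *
          τ.rep.character g = σ.rep.character h⁻¹ * if τ = σ then (Nat.card G : ℂ) else 0 := by
        intro σ
        rw [← sum_character_mul_character_inv, Finset.mul_sum]
        exact Finset.sum_congr rfl fun g _ => by ring
      simp_rw [h1]
      have h2 : ∑ g : G, ((Finset.univ.filter fun k : G => k * g⁻¹ * k⁻¹ = h).card : ℂ) *
          τ.rep.character g = ∑ k : G, τ.rep.character h⁻¹ := by
        simp_rw [Finset.card_filter, Nat.cast_sum, Finset.sum_mul]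
        rw [Finset.sum_comm]
        refine Finset.sum_congr rfl fun k _ => ?_
        rw [Finset.sum_eq_single (k⁻¹ * h⁻¹ * k)]
        · rw [if_pos (by group)]
          have := FDRep.char_conj τ.rep h⁻¹ k⁻¹
          rw [inv_inv] at this
          rw [this]; simp
        · intro b _ hb
          rw [if_neg, Nat.cast_zero, zero_mul]
          intro e
          apply hb
          rw [← e]; group
        · simp
      rw [h2]
      simp [mul_comm]
  have := congrFun hφ g⁻¹
  simp only [φ, inv_inv, Pi.zero_apply] at this
  exact sub_eq_zero.1 this

end Completeness
end IrrChain
end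

noncomputable section

namespace IrrChain

open CategoryTheory

/-! ### Eigenfunctions of the chain -/

section Chain

variable {G : Type} [Group G] [Fintype G]

theorem dim_ne_zero (ρ : Irr G) : (ρ.dim : ℂ) ≠ 0 := by
  intro h
  have h1 := sum_character_mul_character_inv ρ ρ
  rw [if_pos rfl] at h1
  have hd : Module.finrank ℂ ρ.rep = 0 := by exact_mod_cast h
  have h0 : ∀ g, ρ.rep.character g = 0 := by
    intro g
    have := Module.finrank_zero_iff.1 hd
    rw [FDRep.character, Subsingleton.elim (ρ.rep.ρ g) 0, map_zero]
  simp [h0] at h1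
  exact absurd h1.symm (Nat.cast_ne_zero.2 Fintype.card_ne_zero)

theorem mult_eq_sum (H : Subgroup G) [Fintype H] (τ : Irr H) (ρ : Irr G) :
    (mult H τ ρ : ℂ) =
      (Nat.card H : ℂ)⁻¹ * ∑ h : H, ρ.rep.character h * τ.rep.character h⁻¹ := by
  have hG : (Nat.card H : ℂ) ≠ 0 := Nat.cast_ne_zero.2 Nat.card_pos.ne'
  have : Invertible (Nat.card H : ℂ) := invertibleOfNonzero hG
  exact (FDRep.scalar_product_char_eq_finrank_equivariant τ.rep (res H ρ.rep)).symm

/-- Parseval's identity for the two restricted characters, from column orthogonality in `H`. -/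
theorem sum_mult_mul_mult (H : Subgroup G) [Fintype H] (ρ σ : Irr G) :
    ∑ τ : Irr H, (mult H τ ρ : ℂ) * (mult H τ σ : ℂ) =
      (Nat.card H : ℂ)⁻¹ * ∑ h : H, ρ.rep.character h * σ.rep.character (h : G)⁻¹ := by
  classical
  have hH : (Nat.card H : ℂ) ≠ 0 := Nat.cast_ne_zero.2 Nat.card_pos.ne'
  -- Substituting `h⁻¹` for `h` in one factor prepares the product of values at `h⁻¹` and `h'`
  -- without complex conjugation.
  have h1 : ∀ τ : Irr H, (mult H τ σ : ℂ) =
      (Nat.card H : ℂ)⁻¹ * ∑ h : H, σ.rep.character (h : G)⁻¹ * τ.rep.character h := by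
    intro τ
    rw [mult_eq_sum]
    congr 1
    exact Fintype.sum_equiv (Equiv.inv H) _ _ fun h => by simp
  have h2 : ∀ h h' : H, ∑ τ : Irr H, τ.rep.character h⁻¹ * τ.rep.character h' =
      ∑ k : H, if k * h' * k⁻¹ = h then 1 else 0 := by
    intro h h'
    rw [sum_irr_character_mul_character, Finset.card_filter]
    push_cast
    rfl
  calc ∑ τ : Irr H, (mult H τ ρ : ℂ) * (mult H τ σ : ℂ)
      = (Nat.card H : ℂ)⁻¹ * (Nat.card H : ℂ)⁻¹ * ∑ h : H, ∑ h' : H,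
          ρ.rep.character h * σ.rep.character (h' : G)⁻¹ *
            ∑ τ : Irr H, τ.rep.character h⁻¹ * τ.rep.character h' := by
        simp_rw [Finset.mul_sum (s := (Finset.univ : Finset (Irr H)))]
        simp_rw [Finset.sum_comm (s := (Finset.univ : Finset H)) (t := (Finset.univ : Finset (Irr H)))]
        rw [Finset.mul_sum]
        refine Finset.sum_congr rfl fun τ _ => ?_
        rw [h1, mult_eq_sum, mul_mul_mul_comm, Finset.sum_mul_sum]
        congr 1
        exact Finset.sum_congr rfl fun h _ => Finset.sum_congr rfl fun h' _ => by ring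
    _ = (Nat.card H : ℂ)⁻¹ * (Nat.card H : ℂ)⁻¹ * ∑ k : H, ∑ h' : H,
          ρ.rep.character h' * σ.rep.character (h' : G)⁻¹ := by
        congr 1
        simp_rw [h2, Finset.mul_sum]
        rw [Finset.sum_comm]
        rw [Finset.sum_comm (s := Finset.univ) (t := Finset.univ)
          (f := fun (k : H) (h' : H) => ρ.rep.character h' * σ.rep.character (h' : G)⁻¹)]
        refine Finset.sum_congr rfl fun h' _ => ?_
        rw [Finset.sum_comm]
        refine Finset.sum_congr rfl fun k _ => ?_
        rw [Finset.sum_eq_single (k * h' * k⁻¹)]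
        · simp
        · intro b _ hb
          rw [if_neg (Ne.symm hb), mul_zero]
        · simp
    _ = _ := by
        simp only [Finset.sum_const, Finset.card_univ, nsmul_eq_mul, ← Nat.card_eq_fintype_card]
        field_simp

/-- The normalized character values at `g`, as a function on `Irr G`. -/
def charRatio (g : G) : Irr G → ℂ := fun ρ => ρ.rep.character g / ρ.dim

/-- The squared norm of the column at `g` is the order of the centralizer of `g`, which contains
`1`. -/
theorem charRatio_ne_zero (g : G) : charRatio g ≠ 0 := by
  classical
  intro h
  have h1 := sum_irr_character_mul_character g g
  have h0 : ∀ σ : Irr G, σ.rep.character g = 0 := by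
    intro σ
    have := congrFun h σ
    simpa only [charRatio, Pi.zero_apply, div_eq_zero_iff, dim_ne_zero, or_false] using this
  simp only [h0, mul_zero, Finset.sum_const_zero] at h1
  have h2 : (Finset.univ.filter fun k : G => k * g * k⁻¹ = g).card = 0 := by exact_mod_cast h1.symm
  rw [Finset.card_eq_zero, Finset.filter_eq_empty_iff] at h2
  exact h2 (Finset.mem_univ 1) (by simp)

/-- Row orthogonality writes each indicator function as an explicit combination of the columns. -/
theorem span_charRatio : Submodule.span ℂ (Set.range (charRatio (G := G))) = ⊤ := by
  classical
  have hG : (Nat.card G : ℂ) ≠ 0 := Nat.cast_ne_zero.2 Nat.card_pos.ne'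
  have hs : ∀ ρ : Irr G, (Pi.single ρ 1 : Irr G → ℂ) ∈
      Submodule.span ℂ (Set.range (charRatio (G := G))) := by
    intro ρ
    have : (Pi.single ρ 1 : Irr G → ℂ) =
        ∑ g : G, ((Nat.card G : ℂ)⁻¹ * ρ.dim * ρ.rep.character g⁻¹) • charRatio g := by
      ext σ
      have h := sum_character_mul_character_inv σ ρ
      have h' : (∑ g : G, ((Nat.card G : ℂ)⁻¹ * ρ.dim * ρ.rep.character g⁻¹) • charRatio g) σ =
          (Nat.card G : ℂ)⁻¹ * ρ.dim / σ.dim *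
            ∑ g : G, σ.rep.character g * ρ.rep.character g⁻¹ := by
        rw [Finset.sum_apply, Finset.mul_sum]
        refine Finset.sum_congr rfl fun g _ => ?_
        simp only [charRatio, Pi.smul_apply, smul_eq_mul]
        ring
      rw [h', h]
      have := dim_ne_zero ρ
      by_cases e : σ = ρ
      · subst e
        simp only [Pi.single_eq_same, if_true]
        field_simp
      · rw [if_neg e, mul_zero, Pi.single_eq_of_ne e]
    rw [this]
    exact Submodule.sum_mem _ fun g _ => Submodule.smul_mem _ _ (Submodule.subset_span ⟨g, rfl⟩)
  rw [eq_top_iff]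
  intro f _
  rw [pi_eq_sum_univ' f]
  exact Submodule.sum_mem _ fun ρ _ => Submodule.smul_mem _ _ (by convert hs ρ using 1)

open scoped Classical in
/-- The proportion of the elements of `G` which conjugate `g` into `H`. -/
def conjRatio (H : Subgroup G) (g : G) : ℝ :=
  ((Finset.univ.filter fun k : G => k * g * k⁻¹ ∈ H).card : ℝ) / Nat.card G

/-- The normalized character values at `g` form an eigenfunction of the chain. -/
theorem sum_chain_mul_charRatio (H : Subgroup G) (g : G) (ρ : Irr G) :
    ∑ σ : Irr G, ((chain H ρ σ : ℝ) : ℂ) * charRatio g σ =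
      (conjRatio H g : ℂ) * charRatio g ρ := by
  classical
  have hH : (Nat.card H : ℂ) ≠ 0 := Nat.cast_ne_zero.2 Nat.card_pos.ne'
  have h1 : ∀ σ : Irr G, ((chain H ρ σ : ℝ) : ℂ) * charRatio g σ =
      (Nat.card G : ℂ)⁻¹ * (ρ.dim : ℂ)⁻¹ * ∑ h : H, ρ.rep.character h *
        (σ.rep.character (h : G)⁻¹ * σ.rep.character g) := by
    intro σ
    have h2 := sum_mult_mul_mult H ρ σ
    have hσ := dim_ne_zero σ
    simp only [chain, charRatio]
    push_cast
    rw [h2]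
    simp_rw [← mul_assoc]
    rw [← Finset.sum_mul]
    field_simp
  simp_rw [h1]
  -- `dim σ` and `|H|` have cancelled, so the sum over `σ` is a column orthogonality sum: it counts
  -- the `k` conjugating `g` to `h`, where `ρ` has the same character value.
  rw [← Finset.mul_sum, Finset.sum_comm]
  simp_rw [← Finset.mul_sum, sum_irr_character_mul_character, Finset.card_filter]
  push_cast
  simp_rw [Finset.mul_sum (s := (Finset.univ : Finset G))]
  have h3 : ∀ k : G, ∑ h : H, ρ.rep.character h * (if k * g * k⁻¹ = h then 1 else 0) =
      if k * g * k⁻¹ ∈ H then ρ.rep.character g else 0 := by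
    intro k
    split_ifs with hk
    · rw [Finset.sum_eq_single (⟨k * g * k⁻¹, hk⟩ : H)]
      · simp
      · intro b _ hb
        rw [if_neg, mul_zero]
        intro e
        exact hb (Subtype.ext e.symm)
      · simp
    · refine Finset.sum_eq_zero fun h _ => ?_
      rw [if_neg, mul_zero]
      intro e
      exact hk (e ▸ h.2)
  rw [Finset.sum_comm]
  simp_rw [h3]
  rw [← Finset.sum_filter, Finset.sum_const, nsmul_eq_mul, charRatio, conjRatio]
  push_cast
  ring

/-- The eigenvalues of a mixture of chains. -/
theorem eigenvalueSet_mixture {ι : Type*} [Fintype ι] (p : ι → ℝ) (H : ι → Subgroup G) :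
    eigenvalueSet (transitionOp (∑ i, p i • chain (H i))) =
      Set.range fun g : G => ((∑ i, p i * conjRatio (H i) g : ℝ) : ℂ) := by
  set T := transitionOp (∑ i, p i • chain (H i)) with hT
  have hf : ∀ g : G, T (charRatio g) =
      ((∑ i, p i * conjRatio (H i) g : ℝ) : ℂ) • charRatio g := by
    intro g
    ext ρ
    simp only [hT, transitionOp, Matrix.mulVecLin_apply, Matrix.mulVec, dotProduct,
      Matrix.map_apply, Matrix.sum_apply, Matrix.smul_apply, smul_eq_mul, Pi.smul_apply]
    push_cast
    simp_rw [Finset.sum_mul, mul_assoc]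
    rw [Finset.sum_comm]
    simp_rw [← Finset.mul_sum, sum_chain_mul_charRatio]
  ext z
  constructor
  · intro hz
    by_contra hne
    have hne' : ∀ g : G, ((∑ i, p i * conjRatio (H i) g : ℝ) : ℂ) - z ≠ 0 :=
      fun g h => hne ⟨g, sub_eq_zero.1 h⟩
    -- `T - z` rescales every vector of a spanning set by a nonzero factor; it is onto, hence
    -- injective.
    have hsurj : LinearMap.range (T - algebraMap ℂ (Module.End ℂ (Irr G → ℂ)) z) = ⊤ := by
      rw [eq_top_iff, ← span_charRatio, Submodule.span_le]
      rintro _ ⟨g, rfl⟩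
      refine ⟨(((∑ i, p i * conjRatio (H i) g : ℝ) : ℂ) - z)⁻¹ • charRatio g, ?_⟩
      rw [map_smul, LinearMap.sub_apply, hf, Module.algebraMap_end_apply, ← sub_smul,
        smul_smul, inv_mul_cancel₀ (hne' g), one_smul]
    have hinj := LinearMap.injective_iff_surjective.2 (LinearMap.range_eq_top.1 hsurj)
    obtain ⟨v, hv⟩ := (hz : T.HasEigenvalue z).exists_hasEigenvector
    apply hv.2
    apply hinj
    rw [map_zero, LinearMap.sub_apply, hv.apply_eq_smul, Module.algebraMap_end_apply, sub_self]
  · rintro ⟨g, rfl⟩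
    exact Module.End.hasEigenvalue_of_hasEigenvector
      ⟨Module.End.mem_eigenspace_iff.2 (hf g), charRatio_ne_zero g⟩

end Chain
end IrrChain
end

noncomputable section

namespace IrrChain

/-! ### The monoid of faces and the action of the symmetric group -/

/-- A face of the braid arrangement, encoded as a total preorder on the coordinates. -/
@[ext]
structure Face (n : ℕ) where
  /-- The underlying relation. -/
  le : Fin n → Fin n → Prop
  total : ∀ x y, le x y ∨ le y x
  trans : ∀ {x y z}, le x y → le y z → le x z

namespace Face

variable {n : ℕ}

theorem refl (F : Face n) (x : Fin n) : F.le x x := (F.total x x).elim id id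

instance : Finite (Face n) :=
  Finite.of_injective (fun F : Face n => F.le) fun _ _ h => Face.ext h

instance : Fintype (Face n) := Fintype.ofFinite _

/-- The Tits product: `F * G` refines `F` by means of `G`. -/
instance : Mul (Face n) where
  mul F G :=
    { le := fun x y => F.le x y ∧ (F.le y x → G.le x y)
      total := fun x y => by
        have := F.total x y
        have := G.total x y
        tauto
      trans := fun {x y z} h₁ h₂ =>
        ⟨F.trans h₁.1 h₂.1, fun h => G.trans (h₁.2 (F.trans h₂.1 h)) (h₂.2 (F.trans h h₁.1))⟩ }

instance : One (Face n) where
  one :=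
    { le := fun _ _ => True
      total := fun _ _ => Or.inl trivial
      trans := fun _ _ => trivial }

theorem mul_le (F G : Face n) (x y : Fin n) :
    (F * G).le x y ↔ F.le x y ∧ (F.le y x → G.le x y) := Iff.rfl

theorem one_le (x y : Fin n) : (1 : Face n).le x y ↔ True := Iff.rfl

theorem ext_iff' {F G : Face n} : F = G ↔ ∀ x y, F.le x y ↔ G.le x y :=
  ⟨fun h _ _ => h ▸ Iff.rfl, fun h => Face.ext (funext fun x => funext fun y => propext (h x y))⟩

instance : Monoid (Face n) where
  mul_assoc F G H := by
    rw [ext_iff']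
    intro x y
    simp only [mul_le]
    tauto
  one_mul F := by
    rw [ext_iff']
    intro x y
    simp [mul_le, one_le]
  mul_one F := by
    rw [ext_iff']
    intro x y
    simp [mul_le, one_le]

instance : MulDistribMulAction (Equiv.Perm (Fin n)) (Face n) where
  smul g F :=
    { le := fun x y => F.le (g⁻¹ x) (g⁻¹ y)
      total := fun _ _ => F.total _ _
      trans := fun h₁ h₂ => F.trans h₁ h₂ }
  one_smul _ := rfl
  mul_smul g h F := by
    rw [ext_iff']
    intro x y
    change F.le ((g * h)⁻¹ x) ((g * h)⁻¹ y) ↔ F.le (h⁻¹ (g⁻¹ x)) (h⁻¹ (g⁻¹ y))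
    rw [mul_inv_rev]
    rfl
  smul_mul _ _ _ := rfl
  smul_one _ := rfl

theorem smul_le (g : Equiv.Perm (Fin n)) (F : Face n) (x y : Fin n) :
    (g • F).le x y ↔ F.le (g⁻¹ x) (g⁻¹ y) := Iff.rfl

/-- Only pairs inside a common block of `F` matter, so the condition depends on the blocks of `F`
and `G` and not on their order. -/
theorem mul_eq_left_iff {F G : Face n} :
    F * G = F ↔ ∀ x y, F.le x y → F.le y x → G.le x y := by
  rw [ext_iff']
  simp only [mul_le]
  refine forall_congr' fun x => forall_congr' fun y => ?_
  tauto

theorem mul_mul_eq_left_iff {F G H : Face n} : F * (G * H) = F ↔ F * G = F ∧ F * H = F := by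
  constructor
  · intro h
    have h₁ : F * G = F := mul_eq_left_iff.2 fun x y hx hy => (mul_eq_left_iff.1 h x y hx hy).1
    refine ⟨h₁, ?_⟩
    rw [← mul_assoc, h₁] at h
    exact h
  · rintro ⟨h₁, h₂⟩
    rw [← mul_assoc, h₁, h₂]

/-- The number of elements below a given one. -/
def rank (F : Face n) (y : Fin n) : ℕ := Nat.card {x // F.le x y}

theorem rank_le_rank {F : Face n} {x y : Fin n} : F.rank x ≤ F.rank y ↔ F.le x y := by
  constructor
  · intro h
    by_contra hxy
    have hyx := (F.total x y).resolve_left hxy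
    have : F.rank y < F.rank x := by
      have h1 : {z | F.le z y} ⊂ {z | F.le z x} :=
        ⟨fun z hz => F.trans hz hyx, fun hs => hxy (hs (F.refl x))⟩
      exact Set.ncard_lt_ncard h1 (Set.toFinite _)
    omega
  · intro h
    exact Set.ncard_le_ncard (s := {z | F.le z x}) (t := {z | F.le z y})
      (fun z hz => F.trans hz h) (Set.toFinite _)

theorem rank_smul (g : Equiv.Perm (Fin n)) (F : Face n) (y : Fin n) :
    (g • F).rank (g y) = F.rank y := by
  refine Nat.card_congr (Equiv.subtypeEquiv g⁻¹ fun x => ?_)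
  simp [smul_le]

/-- `F` is recovered from its rank function, so a permutation fixing `F` preserves ranks and moves
elements only within blocks. -/
theorem smul_eq_self_iff {g : Equiv.Perm (Fin n)} {F : Face n} :
    g • F = F ↔ ∀ x, F.le x (g x) ∧ F.le (g x) x := by
  constructor
  · intro h x
    have := rank_smul g F x
    rw [h] at this
    exact ⟨rank_le_rank.1 this.ge, rank_le_rank.1 this.le⟩
  · intro h
    have h' : ∀ x, F.le x (g⁻¹ x) ∧ F.le (g⁻¹ x) x := fun x => by
      have := h (g⁻¹ x)
      simpa using this.symm
    rw [ext_iff']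
    intro x y
    rw [smul_le]
    exact ⟨fun e => F.trans (h' x).1 (F.trans e (h' y).2),
      fun e => F.trans (h' x).2 (F.trans e (h' y).1)⟩

/-! ### Standard faces, parabolic subgroups and descents -/

/-- The face of the fundamental chamber whose blocks are the orbits of `S_L`. -/
def std (L : Finset (Fin (n - 1))) : Face n where
  le x y := ∀ i : Fin (n - 1), y.1 ≤ i.1 → i.1 < x.1 → i ∈ L
  total x y := by
    rcases le_total x.1 y.1 with h | h
    · exact Or.inl fun i h₁ h₂ => by omega
    · exact Or.inr fun i h₁ h₂ => by omega
  trans {x y z} h₁ h₂ i hz hx := by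
    rcases lt_or_ge i.1 y.1 with h | h
    · exact h₂ i hz h
    · exact h₁ i h hx

/-- The fundamental chamber. -/
def base : Face n := std ∅

theorem std_le_of_le (L : Finset (Fin (n - 1))) {x y : Fin n} (h : x ≤ y) : (std L).le x y :=
  fun i h₁ h₂ => by
    have : x.1 ≤ y.1 := h
    omega

theorem std_hi_lo {L : Finset (Fin (n - 1))} {i : Fin (n - 1)} :
    (std L).le (hi i) (lo i) ↔ i ∈ L := by
  constructor
  · intro h
    exact h i le_rfl (Nat.lt_succ_self _)
  · intro h j h₁ h₂
    have : j = i := Fin.ext (le_antisymm (Nat.lt_succ_iff.1 h₂) h₁)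
    exact this ▸ h

theorem base_le {x y : Fin n} : (base : Face n).le x y ↔ x ≤ y := by
  constructor
  · intro h
    by_contra hxy
    have hxy' : y.1 < x.1 := not_le.1 hxy
    have hx := x.2
    exact absurd (h ⟨y.1, by omega⟩ le_rfl hxy') (Finset.notMem_empty _)
  · exact std_le_of_le ∅

/-- A reflexive and transitive relation which holds for all adjacent positions between `x` and
`y` holds for `x` and `y`. -/
theorem rel_of_forall_adjacent {R : Fin n → Fin n → Prop} (hR : ∀ x, R x x)
    (hR' : ∀ {x y z}, R x y → R y z → R x z) {x y : Fin n}
    (h : ∀ i : Fin (n - 1), x.1 ≤ i.1 → i.1 < y.1 → R (hi i) (lo i)) (hxy : x ≤ y) :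
    R y x := by
  obtain ⟨k, hk⟩ : ∃ k, x.1 + k = y.1 := ⟨y.1 - x.1, Nat.add_sub_cancel' hxy⟩
  induction k generalizing y with
  | zero =>
    have : x = y := Fin.ext hk
    exact this ▸ hR x
  | succ k ih =>
    have hy := y.2
    let i : Fin (n - 1) := ⟨x.1 + k, by omega⟩
    have h₁ : R (lo i) x := by
      refine ih (y := lo i) (fun j hj₁ hj₂ => h j hj₁ ?_) ?_ rfl
      · have : j.1 < x.1 + k := hj₂
        omega
      · exact Nat.le_add_right _ _
    have h₂ : R (hi i) (lo i) := h i (Nat.le_add_right _ _) (by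
      change x.1 + k < y.1
      omega)
    have : hi i = y := Fin.ext hk
    exact hR' (this ▸ h₂) h₁

/-- A face of the fundamental chamber is one of the standard faces. -/
theorem exists_eq_std {F : Face n} (h : ∀ x y, x ≤ y → F.le x y) : ∃ L, F = std L := by
  classical
  refine ⟨Finset.univ.filter fun i => F.le (hi i) (lo i), ext_iff'.2 fun x y => ?_⟩
  rcases le_total x y with hxy | hxy
  · exact iff_of_true (h x y hxy) (std_le_of_le _ hxy)
  · constructor
    · intro hF i h₁ h₂
      rw [Finset.mem_filter]
      refine ⟨Finset.mem_univ _, F.trans (h _ x ?_) (F.trans hF (h y _ ?_))⟩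
      · exact h₂
      · exact h₁
    · intro hs
      refine rel_of_forall_adjacent F.refl F.trans (fun i h₁ h₂ => ?_) hxy
      have := hs i h₁ h₂
      rw [Finset.mem_filter] at this
      exact this.2

theorem exists_eq_smul_std (F : Face n) : ∃ (g : Equiv.Perm (Fin n)) (L : Finset (Fin (n - 1))),
    F = g • std L := by
  -- Sorting the coordinates by rank moves `F` into the closed fundamental chamber.
  let g := Tuple.sort F.rank
  obtain ⟨L, hL⟩ : ∃ L, g⁻¹ • F = std L := by
    refine exists_eq_std fun x y hxy => ?_
    rw [smul_le, inv_inv, ← rank_le_rank]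
    exact Tuple.monotone_sort F.rank hxy
  exact ⟨g, L, by rw [← hL, smul_inv_smul]⟩

theorem smul_base_injective : Function.Injective fun g : Equiv.Perm (Fin n) => g • (base : Face n) := by
  intro g h hgh
  have h₁ : (h⁻¹ * g) • (base : Face n) = base := by
    rw [mul_smul, inv_smul_eq_iff]
    exact hgh
  rw [smul_eq_self_iff] at h₁
  have h₂ : h⁻¹ * g = 1 := by
    ext x
    have := h₁ x
    rw [base_le, base_le] at this
    rw [le_antisymm this.2 this.1]
    rfl
  exact (inv_mul_eq_one.1 h₂).symm

theorem exists_eq_smul_base {F : Face n} (h : ∀ x y, F.le x y → F.le y x → x = y) :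
    ∃ g : Equiv.Perm (Fin n), F = g • base := by
  obtain ⟨g, L, rfl⟩ := exists_eq_smul_std F
  refine ⟨g, ?_⟩
  have : L = ∅ := by
    rw [Finset.eq_empty_iff_forall_notMem]
    intro i hiL
    have h₁ : (lo i).1 ≤ (hi i).1 := Nat.le_succ _
    have h₂ := h (g (lo i)) (g (hi i)) (by
      simp only [smul_le, Equiv.Perm.inv_def, Equiv.symm_apply_apply]
      exact std_le_of_le L h₁) (by
      simp only [smul_le, Equiv.Perm.inv_def, Equiv.symm_apply_apply]
      exact std_hi_lo.2 hiL)
    have h₃ := congrArg Fin.val (g.injective h₂)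
    simp [lo, hi] at h₃
  rw [this]
  rfl

theorem exists_mul_base_eq (F : Face n) : ∃ g : Equiv.Perm (Fin n), F * base = g • base := by
  refine exists_eq_smul_base fun x y h₁ h₂ => ?_
  exact le_antisymm (base_le.1 (h₁.2 h₂.1)) (base_le.1 (h₂.2 h₁.1))

/-- Two standard faces in the same orbit are equal. -/
theorem smul_std_eq_std {g : Equiv.Perm (Fin n)} {L K : Finset (Fin (n - 1))}
    (h : g • std L = std K) : std L = std K := by
  have hm : ∀ M : Finset (Fin (n - 1)), Monotone (std M).rank := fun M x y hxy =>
    rank_le_rank.2 (std_le_of_le M hxy)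
  have h₁ : (std K).rank ∘ g = (std L).rank := by
    ext x
    rw [Function.comp_apply, ← h, rank_smul]
  -- Both rank functions are monotone and are rearrangements of each other, hence equal.
  have h₂ : (std K).rank ∘ (1 : Equiv.Perm (Fin n)) = (std K).rank ∘ g :=
    Tuple.unique_monotone (hm K) (h₁ ▸ hm L)
  rw [h₁] at h₂
  rw [ext_iff']
  intro x y
  rw [← rank_le_rank, ← rank_le_rank, ← h₂]
  rfl

/-- The stabilizer preserves each block. Blocks lie in orbits of `S_L`, and a group generated by
transpositions contains every permutation of finite support that preserves its orbits. -/
theorem smul_std_eq_self_iff {g : Equiv.Perm (Fin n)} {L : Finset (Fin (n - 1))} :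
    g • std L = std L ↔ g ∈ parabolic L := by
  constructor
  · intro h
    rw [smul_eq_self_iff] at h
    have hS : ∀ f ∈ {s | ∃ i ∈ L, s = Equiv.swap (lo i) (hi i)}, f.IsSwap := by
      rintro _ ⟨i, _, rfl⟩
      refine ⟨lo i, hi i, ?_, rfl⟩
      intro e
      have := congrArg Fin.val e
      simp [lo, hi] at this
    have ho : ∀ x y, x ≤ y → (std L).le y x → y ∈ MulAction.orbit (parabolic L) x := by
      intro x y hxy hyx
      refine rel_of_forall_adjacent
        (R := fun a b => a ∈ MulAction.orbit (parabolic L) b)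
        (fun a => MulAction.mem_orbit_self a) (fun h₁ h₂ => ?_) (fun i h₁ h₂ => ?_) hxy
      · rw [← MulAction.orbit_eq_iff] at h₁ h₂ ⊢
        rw [h₁, h₂]
      · have hs : Equiv.swap (lo i) (hi i) ∈ parabolic L :=
          Subgroup.subset_closure ⟨i, hyx i h₁ h₂, rfl⟩
        exact ⟨⟨_, hs⟩, Equiv.swap_apply_left (lo i) (hi i)⟩
    refine (mem_closure_isSwap hS).2 ⟨Set.toFinite _, fun x => ?_⟩
    rcases le_total x (g x) with hx | hx
    · exact ho x (g x) hx (h x).2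
    · exact (MulAction.mem_orbit_symm).1 (ho (g x) x hx (h x).1)
  · intro h
    have : parabolic L ≤ MulAction.stabilizer (Equiv.Perm (Fin n)) (std L) := by
      rw [parabolic, Subgroup.closure_le]
      rintro _ ⟨i, hiL, rfl⟩
      change Equiv.swap (lo i) (hi i) • std L = std L
      rw [smul_eq_self_iff]
      have h₁ : (std L).le (lo i) (hi i) := std_le_of_le L (Nat.le_succ _ : (lo i).1 ≤ (hi i).1)
      have h₂ : (std L).le (hi i) (lo i) := std_hi_lo.2 hiL
      intro x
      rcases eq_or_ne x (lo i) with rfl | hx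
      · rw [Equiv.swap_apply_left]
        exact ⟨h₁, h₂⟩
      rcases eq_or_ne x (hi i) with rfl | hx'
      · rw [Equiv.swap_apply_right]
        exact ⟨h₂, h₁⟩
      rw [Equiv.swap_apply_of_ne_of_ne hx hx']
      exact ⟨refl _ _, refl _ _⟩
    exact this h

/-- The product sorts each block of `std L` by the values of `g`; this gives the natural order
exactly when `g` increases on every block. -/
theorem std_mul_eq_base_iff {g : Equiv.Perm (Fin n)} {L : Finset (Fin (n - 1))} :
    std L * g⁻¹ • base = base ↔ g ∈ descentFree L := by
  have hd : g ∈ descentFree L ↔ ∀ i ∈ L, g (lo i) ≤ g (hi i) := by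
    rw [descentFree, Finset.mem_filter, Finset.disjoint_right]
    simp [descents]
  rw [hd]
  constructor
  · intro h i hiL
    have h₁ : (std L * g⁻¹ • base).le (lo i) (hi i) := by
      rw [h, base_le]
      exact (Nat.le_succ _ : (lo i).1 ≤ (hi i).1)
    have h₂ := h₁.2 (std_hi_lo.2 hiL)
    rw [smul_le, inv_inv, base_le] at h₂
    exact h₂
  · intro h
    have h₁ : ∀ x y, x ≤ y → (std L * g⁻¹ • base).le x y := by
      intro x y hxy
      refine ⟨std_le_of_le L hxy, fun hyx => ?_⟩
      rw [smul_le, inv_inv, base_le]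
      exact rel_of_forall_adjacent (R := fun a b => g b ≤ g a) (fun a => le_rfl)
        (fun h₁ h₂ => le_trans h₂ h₁) (fun i hi₁ hi₂ => h i (hyx i hi₁ hi₂)) hxy
    rw [ext_iff']
    intro x y
    rw [base_le]
    refine ⟨fun hF => ?_, h₁ x y⟩
    by_contra hxy
    have h₂ := h₁ y x (le_of_not_ge hxy)
    have h₃ := le_antisymm (base_le.1 (hF.2 h₂.1)) (base_le.1 (h₂.2 hF.1))
    exact hxy (g.injective (by simpa using h₃)).le

/-- The permutations `g` for which the chamber of `g • std L` closest to `base` is `h • base`. -/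
theorem smul_std_mul_base_eq_iff {g h : Equiv.Perm (Fin n)} {L : Finset (Fin (n - 1))} :
    g • std L * base = h • base ↔ h ∈ descentFree L ∧ h⁻¹ * g ∈ parabolic L := by
  have h₁ : g • std L * base = h • base ↔ (h⁻¹ * g) • std L * h⁻¹ • base = base := by
    rw [← inv_smul_eq_iff (g := h), smul_mul', smul_smul]
  rw [h₁, ← smul_std_eq_self_iff, ← std_mul_eq_base_iff]
  constructor
  · intro e
    -- A left factor of `base` is a face of the fundamental chamber, and each orbit has only one
    -- such face.
    obtain ⟨K, hK⟩ : ∃ K, (h⁻¹ * g) • std L = std K := by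
      refine exists_eq_std fun x y hxy => ?_
      have := base_le.2 hxy
      rw [← e] at this
      exact this.1
    have hs := hK.trans (smul_std_eq_std hK).symm
    exact ⟨by rwa [hs] at e, hs⟩
  · rintro ⟨e, hs⟩
    rwa [hs]

/-- There are permutations with any given set of ascents. -/
theorem exists_mem_descentFree_iff (K : Finset (Fin (n - 1))) :
    ∃ g : Equiv.Perm (Fin n), ∀ L, g ∈ descentFree L ↔ L ⊆ K := by
  -- The chamber listing the blocks of `std K` in reverse order, each block increasing; the inverse
  -- of its permutation descends exactly outside `K`.
  let E : Face n :=
    { le := fun x y => (std K).le y x ∧ ((std K).le x y → x ≤ y)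
      total := fun x y => by
        have := (std K).total x y
        have := le_total x y
        tauto
      trans := fun {x y z} h₁ h₂ => ⟨(std K).trans h₂.1 h₁.1, fun h =>
        (h₁.2 ((std K).trans h h₂.1)).trans (h₂.2 ((std K).trans h₁.1 h))⟩ }
  obtain ⟨w, hw⟩ : ∃ w : Equiv.Perm (Fin n), E = w • base :=
    exists_eq_smul_base fun x y h₁ h₂ => le_antisymm (h₁.2 h₂.1) (h₂.2 h₁.1)
  refine ⟨w⁻¹, fun L => ?_⟩
  rw [← std_mul_eq_base_iff, inv_inv, ← hw]
  constructor
  · intro h i hiL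
    have h₁ : (std L * E).le (lo i) (hi i) := by
      rw [h, base_le]
      exact (Nat.le_succ _ : (lo i).1 ≤ (hi i).1)
    exact std_hi_lo.1 (h₁.2 (std_hi_lo.2 hiL)).1
  · intro hLK
    have hle : ∀ x y, (std L).le x y → (std K).le x y := fun x y h i h₁ h₂ => hLK (h i h₁ h₂)
    have h₁ : ∀ x y, x ≤ y → (std L * E).le x y := fun x y hxy =>
      ⟨std_le_of_le L hxy, fun hyx => ⟨hle y x hyx, fun _ => hxy⟩⟩
    rw [ext_iff']
    intro x y
    rw [base_le]
    refine ⟨fun hF => ?_, h₁ x y⟩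
    by_contra hxy
    have h₂ := h₁ y x (le_of_not_ge hxy)
    exact hxy ((hF.2 h₂.1).2 (hle x y hF.1))

/-! ### Faces and cycle partitions -/

/-- A permutation whose cycles are the blocks of `F` fixes exactly the faces which are coarser
than `F` up to the order of the blocks. -/
theorem mul_eq_left_iff_smul_eq {F G : Face n} {h : Equiv.Perm (Fin n)}
    (hF : ∀ x y, h.SameCycle x y ↔ F.le x y ∧ F.le y x) : F * G = F ↔ h • G = G := by
  rw [mul_eq_left_iff]
  constructor
  · intro e
    rw [smul_eq_self_iff]
    intro x
    obtain ⟨h₁, h₂⟩ := (hF x (h x)).1 ⟨1, by simp⟩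
    exact ⟨e _ _ h₁ h₂, e _ _ h₂ h₁⟩
  · intro e x y h₁ h₂
    obtain ⟨k, rfl⟩ := (hF x y).2 ⟨h₁, h₂⟩
    have hk : h ^ k ∈ MulAction.stabilizer (Equiv.Perm (Fin n)) G := Subgroup.zpow_mem _ e k
    exact (smul_eq_self_iff.1 hk x).1

theorem mul_smul_std_eq_left_iff {F : Face n} {g h : Equiv.Perm (Fin n)}
    {L : Finset (Fin (n - 1))} (hF : ∀ x y, h.SameCycle x y ↔ F.le x y ∧ F.le y x) :
    F * g • std L = F ↔ g⁻¹ * h * g ∈ parabolic L := by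
  rw [mul_eq_left_iff_smul_eq hF, ← smul_std_eq_self_iff, mul_smul, mul_smul, inv_smul_eq_iff]

theorem exists_face_sameCycle (h : Equiv.Perm (Fin n)) :
    ∃ F : Face n, ∀ x y, h.SameCycle x y ↔ F.le x y ∧ F.le y x := by
  let s := Equiv.Perm.SameCycle.setoid h
  -- An arbitrary ordering of the cycles; only the blocks of the face are prescribed.
  obtain ⟨m, ⟨e⟩⟩ := Finite.exists_equiv_fin (Quotient s)
  let f : Fin n → Fin m := fun x => e (Quotient.mk s x)
  refine ⟨⟨fun x y => f x ≤ f y, fun x y => le_total _ _, fun h₁ h₂ => h₁.trans h₂⟩, fun x y => ?_⟩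
  have h₁ : h.SameCycle x y ↔ f x = f y := by
    simp only [f, e.injective.eq_iff]
    exact Quotient.eq (r := s).symm
  rw [h₁]
  exact ⟨fun h => ⟨h.le, h.ge⟩, fun h => le_antisymm h.1 h.2⟩

theorem exists_perm_sameCycle (F : Face n) :
    ∃ h : Equiv.Perm (Fin n), ∀ x y, h.SameCycle x y ↔ F.le x y ∧ F.le y x := by
  classical
  -- The blocks are the fibres of `rank`; one full cycle on each fibre is glued into `τ`.
  have hc : ∀ k : ℕ, ∃ σ : Equiv.Perm {x // F.rank x = k}, ∀ a b, σ.SameCycle a b := by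
    intro k
    obtain ⟨σ, hσ, -⟩ := Finset.exists_cycleOn (Finset.univ : Finset {x // F.rank x = k})
    exact ⟨σ, fun a b => hσ.2 (by simp) (by simp)⟩
  choose σ hσ using hc
  let e := Equiv.sigmaFiberEquiv F.rank
  let τ : Equiv.Perm (Fin n) := e.permCongr (Equiv.Perm.sigmaCongrRight σ)
  have hτ : ∀ (k : ℤ) (x : Fin n), ((τ ^ k) x) = ((σ (F.rank x) ^ k) ⟨x, rfl⟩).1 := by
    intro k x
    let Φ : (∀ k : ℕ, Equiv.Perm {x // F.rank x = k}) →* Equiv.Perm (Fin n) :=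
      { toFun := fun ρ => e.permCongr (Equiv.Perm.sigmaCongrRight ρ)
        map_one' := by
          ext x
          simp
        map_mul' := fun ρ₁ ρ₂ => by
          ext x
          simp }
    change ((Φ σ ^ k) x) = _
    rw [← map_zpow]
    rfl
  refine ⟨τ, fun x y => ?_⟩
  have h₁ : F.le x y ∧ F.le y x ↔ F.rank y = F.rank x := by
    rw [← rank_le_rank, ← rank_le_rank]
    exact ⟨fun h => le_antisymm h.2 h.1, fun h => ⟨h.ge, h.le⟩⟩
  rw [h₁]
  constructor
  · rintro ⟨k, rfl⟩
    rw [hτ]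
    exact ((σ (F.rank x) ^ k) ⟨x, rfl⟩).2
  · intro hxy
    obtain ⟨k, hk⟩ := hσ (F.rank x) ⟨x, rfl⟩ ⟨y, hxy⟩
    exact ⟨k, by rw [hτ, hk]⟩

end Face
end IrrChain
end

noncomputable section

namespace IrrChain

open Polynomial

/-! ### Eigenvalues of multiplication operators -/

section Spectrum

variable {A : Type*} [Ring A] [Algebra ℂ A]

theorem aeval_mulLeft_eq (a : A) (q : ℂ[X]) :
    aeval (LinearMap.mulLeft ℂ a) q = LinearMap.mulLeft ℂ (aeval a q) :=
  aeval_algHom_apply (Algebra.lmul ℂ A) a q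

theorem aeval_mulRight_eq (a : A) (q : ℂ[X]) :
    aeval (LinearMap.mulRight ℂ a) q = LinearMap.mulRight ℂ (aeval a q) := by
  ext v
  simp [aeval_eq_sum_range, LinearMap.pow_mulRight, Finset.mul_sum]

variable [FiniteDimensional ℂ A]

/-- Eigenvalues are the roots of the minimal polynomial; this form compares spectra through
annihilating polynomials alone. -/
theorem mem_eigenvalueSet_iff {V : Type*} [AddCommGroup V] [Module ℂ V] [FiniteDimensional ℂ V]
    (T : Module.End ℂ V) (z : ℂ) :
    z ∈ eigenvalueSet T ↔ ∀ q : ℂ[X], aeval T q = 0 → q.eval z = 0 := by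
  change T.HasEigenvalue z ↔ _
  rw [Module.End.hasEigenvalue_iff_isRoot]
  exact ⟨fun h q hq => h.dvd (minpoly.dvd ℂ T hq), fun h => h _ (minpoly.aeval ℂ T)⟩

theorem mem_eigenvalueSet_mulLeft_iff (a : A) (z : ℂ) :
    z ∈ eigenvalueSet (LinearMap.mulLeft ℂ a) ↔
      ∀ q : ℂ[X], aeval a q = 0 → q.eval z = 0 := by
  rw [mem_eigenvalueSet_iff]
  refine forall_congr' fun q => imp_congr_left ?_
  rw [aeval_mulLeft_eq, LinearMap.mulLeft_eq_zero_iff]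

theorem mem_eigenvalueSet_mulRight_iff (a : A) (z : ℂ) :
    z ∈ eigenvalueSet (LinearMap.mulRight ℂ a) ↔
      ∀ q : ℂ[X], aeval a q = 0 → q.eval z = 0 := by
  rw [mem_eigenvalueSet_iff]
  refine forall_congr' fun q => imp_congr_left ?_
  rw [aeval_mulRight_eq, LinearMap.mulRight_eq_zero_iff]

end Spectrum

namespace Face

variable {n : ℕ}

/-! ### The face algebra: characters, triangularity and invariants -/

open scoped Classical in
/-- The character of the face monoid attached to the support of `F`. -/
def charHom (F : Face n) : Face n →* ℂ where
  toFun G := if F * G = F then 1 else 0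
  map_one' := by simp
  map_mul' G H := by
    simp only [mul_mul_eq_left_iff, ite_and, ite_mul, one_mul, zero_mul]

/-- The linear extension of `charHom`. -/
def char (F : Face n) : MonoidAlgebra ℂ (Face n) →ₐ[ℂ] ℂ :=
  MonoidAlgebra.lift ℂ ℂ (Face n) F.charHom

open scoped Classical in
theorem char_single (F G : Face n) (c : ℂ) :
    F.char (MonoidAlgebra.single G c) = if F * G = F then c else 0 := by
  simp [char, charHom]

open scoped Classical in
theorem char_eq_sum (F : Face n) (x : MonoidAlgebra ℂ (Face n)) :
    F.char x = ∑ G, if F * G = F then x.coeff G else 0 := by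
  conv_lhs => rw [← MonoidAlgebra.sum_coeff_single x, Finsupp.sum_fintype _ _ (by simp), map_sum]
  simp_rw [char_single]

/-- Right multiplication in the algebra of faces is triangular. -/
theorem exists_char_eq_of_mem_eigenvalueSet {x : MonoidAlgebra ℂ (Face n)} {z : ℂ}
    (hz : z ∈ eigenvalueSet (LinearMap.mulRight ℂ x)) : ∃ F : Face n, F.char x = z := by
  classical
  obtain ⟨v, hv⟩ := (show Module.End.HasEigenvalue _ z from hz).exists_hasEigenvector
  have hne : v.coeff.support.Nonempty := by
    rw [Finsupp.support_nonempty_iff]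
    intro h
    exact hv.2 (MonoidAlgebra.coeff_eq_zero.1 h)
  -- Choose `F` with the most related pairs. A product `H * G = F` forces `H` to be coarser than
  -- `F`, so within the support only `H = F` contributes to the coefficient at `F`.
  obtain ⟨F, hF, hmax⟩ := v.coeff.support.exists_max_image
    (fun F => Set.ncard {q : Fin n × Fin n | F.le q.1 q.2}) hne
  refine ⟨F, ?_⟩
  have hvF : v.coeff F ≠ 0 := Finsupp.mem_support_iff.1 hF
  have h1 : (v * x).coeff F = z * v.coeff F := by
    have := congrArg (fun y => y.coeff F) hv.apply_eq_smul
    simpa using this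
  have h2 : (v * x).coeff F = v.coeff F * F.char x := by
    rw [MonoidAlgebra.coeff_mul, Finsupp.sum, Finset.sum_eq_single F]
    · rw [Finsupp.sum_fintype _ _ (by simp), char_eq_sum, Finset.mul_sum]
      exact Finset.sum_congr rfl fun G _ => by rw [mul_ite, mul_zero]
    · intro H hH hHF
      refine Finset.sum_eq_zero fun G _ => if_neg fun e => hHF ?_
      have hsub : {q : Fin n × Fin n | F.le q.1 q.2} ⊆ {q | H.le q.1 q.2} := by
        rintro ⟨a, b⟩ hab
        rw [← e] at hab
        exact hab.1
      have heq := Set.eq_of_subset_of_ncard_le hsub (hmax H hH) (Set.toFinite _)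
      rw [ext_iff']
      intro a b
      exact (Set.ext_iff.1 heq (a, b)).symm
    · intro h
      exact absurd hF h
  rw [h2, mul_comm] at h1
  exact mul_right_cancel₀ hvF h1

/-- The action of a permutation on the algebra of faces. -/
def permHom (g : Equiv.Perm (Fin n)) : MonoidAlgebra ℂ (Face n) →ₐ[ℂ] MonoidAlgebra ℂ (Face n) :=
  MonoidAlgebra.mapDomainAlgHom ℂ ℂ (MulDistribMulAction.toMonoidHom (Face n) g)

theorem permHom_single (g : Equiv.Perm (Fin n)) (F : Face n) (c : ℂ) :
    permHom g (MonoidAlgebra.single F c) = MonoidAlgebra.single (g • F) c := by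
  simp [permHom]

theorem coeff_permHom (g : Equiv.Perm (Fin n)) (y : MonoidAlgebra ℂ (Face n)) (F : Face n) :
    (permHom g y).coeff (g • F) = y.coeff F := by
  change (MonoidAlgebra.mapDomain (fun F : Face n => g • F) y).coeff (g • F) = _
  rw [MonoidAlgebra.coeff_mapDomain]
  exact Finsupp.mapDomain_apply (MulAction.injective g) _ _

/-- Multiplication by the fundamental chamber is injective on invariant elements. -/
theorem eq_zero_of_mul_base_eq_zero {y : MonoidAlgebra ℂ (Face n)}
    (hy : ∀ g, permHom g y = y) (h0 : y * MonoidAlgebra.single base 1 = 0) : y = 0 := by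
  classical
  have hinv : ∀ (g : Equiv.Perm (Fin n)) F, y.coeff (g • F) = y.coeff F := fun g F => by
    conv_lhs => rw [← hy g]
    exact coeff_permHom g y F
  have hsum : ∀ E : Face n, ∑ F, (if F * base = E then y.coeff F else 0) = 0 := by
    intro E
    have h1 : (y * MonoidAlgebra.single base 1).coeff E = 0 := by rw [h0]; rfl
    rw [MonoidAlgebra.coeff_mul, Finsupp.sum_fintype _ _ (by simp)] at h1
    simpa using h1
  have hstd : ∀ K : Finset (Fin (n - 1)), y.coeff (std K) = 0 := by
    intro K
    induction K using Finset.strongInduction with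
    | H K ih =>
      -- At the chamber `w • base` only the faces `w • std L` with `L ⊆ K` contribute; by induction
      -- the term for `K` alone survives.
      obtain ⟨w, hw⟩ := exists_mem_descentFree_iff K
      have h1 := hsum (w • base)
      rw [Finset.sum_eq_single (w • std K)] at h1
      · rwa [if_pos (smul_std_mul_base_eq_iff.2 ⟨(hw K).2 subset_rfl, by
          rw [inv_mul_cancel]; exact one_mem _⟩), hinv] at h1
      · intro F _ hF
        split_ifs with e
        · obtain ⟨g, L, rfl⟩ := exists_eq_smul_std F
          obtain ⟨h2, h3⟩ := smul_std_mul_base_eq_iff.1 e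
          rw [hinv]
          refine ih L (((hw L).1 h2).ssubset_of_ne ?_)
          rintro rfl
          apply hF
          rw [← smul_std_eq_self_iff, mul_smul, inv_smul_eq_iff] at h3
          exact h3
        · rfl
      · simp
  rw [← MonoidAlgebra.coeff_eq_zero]
  ext F
  obtain ⟨g, L, rfl⟩ := exists_eq_smul_std F
  rw [hinv, hstd]
  rfl

/-! ### Transfer between the face algebra and the group algebra -/

/-- Sums over all permutations of products with the fundamental chamber. -/
theorem sum_smul_std_mul_base {M : Type*} [AddCommMonoid M] (L : Finset (Fin (n - 1)))
    (φ : Face n → M) :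
    ∑ g : Equiv.Perm (Fin n), φ (g • std L * base) =
      ∑ h ∈ descentFree L, Nat.card (parabolic L) • φ (h • base) := by
  classical
  choose π hπ using fun g : Equiv.Perm (Fin n) => exists_mul_base_eq (g • std L)
  have hmem : ∀ g ∈ (Finset.univ : Finset (Equiv.Perm (Fin n))), π g ∈ descentFree L :=
    fun g _ => (smul_std_mul_base_eq_iff.1 (hπ g)).1
  -- The fibre over `h` is the coset `h S_L`, which produces the factor `|S_L|`.
  rw [← Finset.sum_fiberwise_of_maps_to hmem]
  refine Finset.sum_congr rfl fun h hh => ?_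
  have h1 : ∀ g, π g = h ↔ h⁻¹ * g ∈ parabolic L := by
    intro g
    constructor
    · rintro rfl
      exact (smul_std_mul_base_eq_iff.1 (hπ g)).2
    · intro hg
      apply smul_base_injective
      change π g • base = h • base
      rw [← hπ g, smul_std_mul_base_eq_iff]
      exact ⟨hh, hg⟩
  rw [Finset.sum_congr rfl (g := fun _ => φ (h • base)), Finset.sum_const]
  · congr 1
    rw [← Fintype.card_coe, ← Nat.card_eq_fintype_card]
    refine Nat.card_congr (Equiv.subtypeEquiv (Equiv.mulLeft h⁻¹) fun g => ?_)
    simp [h1]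
  · intro g hg
    rw [hπ g, (Finset.mem_filter.1 hg).2]

/-- The invariant element of the algebra of faces attached to the weights `p`. -/
def weight (p : Finset (Fin (n - 1)) → ℝ) : MonoidAlgebra ℂ (Face n) :=
  ∑ L, ∑ g : Equiv.Perm (Fin n),
    MonoidAlgebra.single (g • std L) ((p L / (n.factorial : ℝ) : ℝ) : ℂ)

theorem permHom_weight (p : Finset (Fin (n - 1)) → ℝ) (g : Equiv.Perm (Fin n)) :
    permHom g (weight p) = weight p := by
  simp only [weight, map_sum, permHom_single, smul_smul]
  exact Finset.sum_congr rfl fun L _ => Fintype.sum_equiv (Equiv.mulLeft g) _ _ fun h => rfl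

theorem char_weight (p : Finset (Fin (n - 1)) → ℝ) {F : Face n} {h : Equiv.Perm (Fin n)}
    (hF : ∀ x y, h.SameCycle x y ↔ F.le x y ∧ F.le y x) :
    F.char (weight p) = ((∑ L, p L * conjRatio (parabolic L) h : ℝ) : ℂ) := by
  classical
  simp only [weight, map_sum, char_single, mul_smul_std_eq_left_iff hF]
  push_cast
  refine Finset.sum_congr rfl fun L _ => ?_
  rw [← Finset.sum_filter, Finset.sum_const, nsmul_eq_mul, conjRatio]
  have : (Finset.univ.filter fun g : Equiv.Perm (Fin n) => g⁻¹ * h * g ∈ parabolic L).card =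
      (Finset.univ.filter fun g : Equiv.Perm (Fin n) => g * h * g⁻¹ ∈ parabolic L).card :=
    Finset.card_equiv (Equiv.inv _) fun g => by simp
  rw [this]
  simp only [Nat.card_eq_fintype_card, Fintype.card_perm, Fintype.card_fin]
  push_cast
  ring

/-- The embedding of the group algebra onto the span of the chambers. -/
def chamberMap : MonoidAlgebra ℂ (Equiv.Perm (Fin n)) →ₗ[ℂ] MonoidAlgebra ℂ (Face n) :=
  MonoidAlgebra.mapDomainLinearMap ℂ ℂ fun g => g • base

theorem chamberMap_single (g : Equiv.Perm (Fin n)) (c : ℂ) :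
    chamberMap (MonoidAlgebra.single g c) = MonoidAlgebra.single (g • base) c := by
  simp [chamberMap]

theorem chamberMap_injective : Function.Injective (chamberMap (n := n)) :=
  MonoidAlgebra.mapDomain_injective smul_base_injective

/-- At the fundamental chamber this is the coset count. Invariance of `weight p` carries it to `w •
base` by left translation, which commutes with right multiplication by `shuffle p`. -/
theorem weight_mul_chamberMap (p : Finset (Fin (n - 1)) → ℝ)
    (v : MonoidAlgebra ℂ (Equiv.Perm (Fin n))) :
    weight p * chamberMap v = chamberMap (v * shuffle p) := by
  induction v using MonoidAlgebra.induction_linear with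
  | zero => simp
  | add v w hv hw => rw [map_add, mul_add, hv, hw, add_mul, map_add]
  | single w c =>
    have h1 : weight p * MonoidAlgebra.single base c =
        chamberMap (MonoidAlgebra.single 1 c * shuffle p) := by
      simp only [weight, shuffle, Finset.sum_mul, Finset.mul_sum, map_sum,
        MonoidAlgebra.single_mul_single, chamberMap_single, one_mul]
      refine Finset.sum_congr rfl fun L _ => ?_
      rw [sum_smul_std_mul_base L fun F =>
        MonoidAlgebra.single F (((p L / (n.factorial : ℝ) : ℝ) : ℂ) * c)]
      refine Finset.sum_congr rfl fun h _ => ?_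
      rw [MonoidAlgebra.smul_single, nsmul_eq_mul]
      congr 1
      push_cast
      ring
    have h2 : ∀ u : MonoidAlgebra ℂ (Equiv.Perm (Fin n)),
        permHom w (chamberMap u) = chamberMap (MonoidAlgebra.single w 1 * u) := by
      intro u
      induction u using MonoidAlgebra.induction_linear with
      | zero => simp
      | add u v hu hv => simp only [map_add, mul_add, hu, hv]
      | single g d =>
        rw [chamberMap_single, permHom_single, MonoidAlgebra.single_mul_single, one_mul,
          chamberMap_single, mul_smul]
    have h3 := congrArg (permHom w) h1
    rw [map_mul, permHom_weight, permHom_single, h2, ← mul_assoc,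
      MonoidAlgebra.single_mul_single, one_mul, mul_one] at h3
    rw [chamberMap_single, h3]

theorem aeval_weight_mul_chamberMap (p : Finset (Fin (n - 1)) → ℝ) (q : ℂ[X])
    (v : MonoidAlgebra ℂ (Equiv.Perm (Fin n))) :
    aeval (weight p) q * chamberMap v = chamberMap (v * aeval (shuffle p) q) := by
  induction q using Polynomial.induction_on' generalizing v with
  | add q r hq hr => simp only [map_add, add_mul, mul_add, hq, hr]
  | monomial k c =>
    have hk : ∀ v, weight p ^ k * chamberMap v = chamberMap (v * shuffle p ^ k) := by
      induction k with
      | zero => simp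
      | succ k ih =>
        intro v
        rw [pow_succ, mul_assoc, weight_mul_chamberMap, ih, mul_assoc, ← pow_succ']
    rw [aeval_monomial, aeval_monomial, mul_assoc, hk, ← Algebra.smul_def, ← Algebra.smul_def,
      mul_smul_comm, map_smul]

theorem aeval_shuffle_eq_zero_iff (p : Finset (Fin (n - 1)) → ℝ) (q : ℂ[X]) :
    aeval (shuffle p) q = 0 ↔ aeval (weight p) q = 0 := by
  have h := aeval_weight_mul_chamberMap p q 1
  rw [one_mul] at h
  constructor
  · intro h0
    refine eq_zero_of_mul_base_eq_zero (fun g => ?_) ?_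
    · rw [← aeval_algHom_apply, permHom_weight]
    · rw [h0, map_zero, MonoidAlgebra.one_def, chamberMap_single, one_smul] at h
      exact h
  · intro h0
    rw [h0, zero_mul] at h
    exact chamberMap_injective (h.symm.trans (map_zero _).symm)

/-- Triangularity shows that every root is a diagonal entry. Conversely, a diagonal entry is the
value of an algebra homomorphism to `ℂ`, so every annihilating polynomial vanishes there. -/
theorem eval_eq_zero_iff_mem_range (p : Finset (Fin (n - 1)) → ℝ) (z : ℂ) :
    (∀ q : ℂ[X], aeval (shuffle p) q = 0 → q.eval z = 0) ↔
      z ∈ Set.range fun h : Equiv.Perm (Fin n) =>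
        ((∑ L, p L * conjRatio (parabolic L) h : ℝ) : ℂ) := by
  simp_rw [aeval_shuffle_eq_zero_iff]
  constructor
  · intro hz
    obtain ⟨F, hF⟩ := exists_char_eq_of_mem_eigenvalueSet
      ((mem_eigenvalueSet_mulRight_iff (weight p) z).2 hz)
    obtain ⟨h, hh⟩ := exists_perm_sameCycle F
    exact ⟨h, (char_weight p hh).symm.trans hF⟩
  · rintro ⟨h, rfl⟩ q hq
    obtain ⟨F, hF⟩ := exists_face_sameCycle h
    change q.eval ((∑ L, p L * conjRatio (parabolic L) h : ℝ) : ℂ) = 0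
    rw [← char_weight p hF, ← coe_aeval_eq_eval, aeval_algHom_apply, hq, map_zero]

end Face
end IrrChain
end

theorem mainTheorem5 (n : ℕ) (p : Finset (Fin (n - 1)) → ℝ)
    (hp : ∀ L, 0 ≤ p L) (hp1 : ∑ L, p L = 1) :
    IrrChain.eigenvalueSet (IrrChain.transitionOp (IrrChain.mixedChain p)) =
        IrrChain.eigenvalueSet (LinearMap.mulLeft ℂ (IrrChain.shuffle p)) ∧
      IrrChain.eigenvalueSet (IrrChain.transitionOp (IrrChain.mixedChain p)) =
        IrrChain.eigenvalueSet (LinearMap.mulRight ℂ (IrrChain.shuffle p)) := by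
  have h := IrrChain.eigenvalueSet_mixture p (fun L => IrrChain.parabolic (n := n) L)
  rw [IrrChain.mixedChain, h]
  constructor
  · ext z
    rw [IrrChain.mem_eigenvalueSet_mulLeft_iff, IrrChain.Face.eval_eq_zero_iff_mem_range]
  · ext z
    rw [IrrChain.mem_eigenvalueSet_mulRight_iff, IrrChain.Face.eval_eq_zero_iff_mem_range]
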